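/- **Theorem 5.8.** Let $X$ be a proper geodesic Gromov hyperbolic metric space, with base point $a\in X$ and Gromov products $\langle x,y\rangle_p=\tfrac12(d(x,p)+d(y,p)-d(x,y))$. A *simple end* of $X$ is a sequence that meets every bounded set for only finitely many indices; let $\mathcal H(X)$ be the simple coarse structure on $X$ whose bounded sets are the sets of finite diameter and in which two simple ends $(x_n),(y_n)$ are equivalent iff $\langle x_n,y_n\rangle_p\to\infty$ for some $p\in X$. Let $\partial X$ be the Gromov boundary: classes of sequences with $\langle x_i,x_j\rangle_a\to\infty$ as $i,j\to\infty$, where $(x_i)\sim(y_j)$ iff $\langle x_i,y_j\rangle_a\to\infty$ as $i,j\to\infty$. Topologize $X\cup\partial X$ so that $X$ is open with its metric topology and a neighbourhood basis at $p\in\partial X$ is given by the sets $U'(p,r)$, $r\ge 0$, consisting of the $q\in\partial X$ with $\liminf_{i,j}\langle x_i,y_j\rangle_a\ge r$ for some $(x_i)\in p$, $(y_j)\in q$, and of the $y\in X$ with $\liminf_i\langle x_i,y\rangle_a\ge r$ for some $(x_i)\in p$; topologize $\partial X$ by the sets $U'(p,r)\cap\partial X$. Then: 1. $X\cup\partial X$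 is a Hausdorff compactification of $X$, its corona (the complement of $X$) is $\partial X$, and $\partial X\to X\cup\partial X$ is a topological embedding. 2. The simple coarse structure that $\bar X=X\cup\partial X$ induces on $X$ equals $\mathcal H(X)$. Here the induced structure has as bounded sets the $A\subseteq X$ with $\operatorname{cl}_{\bar X}A\subseteq X$, and two simple ends $(x_n),(y_n)$ are equivalent iff for every $b:\mathbb N\to\mathbb N$ with $b(n)\to\infty$ one has $\operatorname{cl}_{\bar X}\{x_{b(n)}\}\setminus X=\operatorname{cl}_{\bar X}\{y_{b(n)}\}\setminus X$. 3. $X\cup\partial X$ is the Higson compactification of $\mathcal H(X)$: the bounded sets of $\mathcal H(X)$ are exactly the subsets of $X$ with compact closure, and a function $g:X\to[0,1]$ extends continuously to $X\cup\partial X$ iff $g$ is continuous and slowly oscillating, i.e. $|g(x_n)-g(y_n)|\to0$ for all equivalent simple ends $(x_n),(y_n)$. 4. Consequently the Higson corona of $\mathcal H(X)$ is the Gromov boundary: for every Higson compactification $Y$ of $\mathcal H(X)$ (a Hausdorff compactification of $X$ with the property in 3), there is a homeomorphism $X\cup\partial X\to Y$ that is the identity on $X$ and restricts to a homeomorphism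 of $\partial X$ onto the Higson corona $Y\setminus X$. -/

import Mathlib

open Filter Topology Set

/-! ### Bounded structures, simple ends, simple coarse structures -/

/-- A bounded structure on a set `X`. -/
structure BoundedStructure (X : Type*) where
  /-- the family of bounded subsets -/
  sets : Set (Set X)
  singleton_mem : ∀ x : X, {x} ∈ sets
  subset_mem : ∀ A C : Set X, C ∈ sets → A ⊆ C → A ∈ sets
  union_mem : ∀ A C : Set X, A ∈ sets → C ∈ sets → (A ∩ C).Nonempty → A ∪ C ∈ sets

/-- A simple end is a sequence that visits every bounded set only finitely often. -/
def BoundedStructure.IsSimpleEnd {X : Type*} (B : BoundedStructure X) (x : ℕ → X) : Prop :=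
  ∀ A ∈ B.sets, {n : ℕ | x n ∈ A}.Finite

/-- The type of simple ends of a set with a bounded structure. -/
def BoundedStructure.SimpleEnd {X : Type*} (B : BoundedStructure X) : Type _ :=
  {x : ℕ → X // B.IsSimpleEnd x}

/-- A simple coarse structure on `X`: a bounded structure together with an equivalence relation
on the set of its simple ends. -/
structure SimpleCoarseStructure (X : Type*) where
  /-- the bounded structure -/
  bounded : BoundedStructure X
  /-- the equivalence relation on the set of simple ends -/
  equiv : Setoid bounded.SimpleEnd

/-- A function to a metric space is slowly oscillating if it sends equivalent simple ends to
sequences whose distance tends to zero. -/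
def SimpleCoarseStructure.SlowlyOscillating {X Z : Type*} [MetricSpace Z]
    (S : SimpleCoarseStructure X) (f : X → Z) : Prop :=
  ∀ x y : S.bounded.SimpleEnd, S.equiv x y →
    Tendsto (fun n => dist (f (x.1 n)) (f (y.1 n))) atTop (𝓝 0)

/-- A simple coarse structure is compatible with the topology if its bounded sets are exactly the
pre-compact sets. -/
def SimpleCoarseStructure.IsCompatible {X : Type*} [TopologicalSpace X]
    (S : SimpleCoarseStructure X) : Prop :=
  ∀ A : Set X, A ∈ S.bounded.sets ↔ IsCompact (closure A)

/-! ### Extensions, compactifications, the Higson compactification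

A space `Y` containing `X` is given by a map `e : X → Y`; the corona is the complement of the
image of `e`. -/

/-- The corona `Y \ X` of an extension `e : X → Y`. -/
def corona {X Y : Type*} (e : X → Y) : Set Y := (range e)ᶜ

/-- Bounded sets: the subsets of `X` whose closure in the extension is contained in `X`. -/
def extensionBoundedStructure {X Y : Type*} [TopologicalSpace Y] [T1Space Y] (e : X → Y) :
    BoundedStructure X where
  sets := {A | closure (e '' A) ⊆ range e}
  singleton_mem x := by
    simp only [mem_ofPred_eq, image_singleton, closure_singleton, singleton_subset_iff]
    exact mem_range_self x
  subset_mem _ _ hC h := (closure_mono (image_mono h)).trans hC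
  union_mem _ _ hA hC _ := by
    simp only [mem_ofPred_eq, image_union, closure_union]
    exact union_subset hA hC

/-- The simple coarse structure induced on `X` by an extension `e : X → Y`: two simple ends are
equivalent if, along every reindexing tending to infinity, the closures in `Y` of their images have
the same trace on the corona. -/
def extensionSCS {X Y : Type*} [TopologicalSpace Y] [T1Space Y] (e : X → Y) :
    SimpleCoarseStructure X where
  bounded := extensionBoundedStructure e
  equiv :=
    { r := fun x y => ∀ b : ℕ → ℕ, Tendsto b atTop atTop →
        closure (range fun n => e (x.1 (b n))) ∩ corona e =
          closure (range fun n => e (y.1 (b n))) ∩ corona e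
      iseqv :=
        { refl := fun _ _ _ => rfl
          symm := fun h b hb => (h b hb).symm
          trans := fun h h' b hb => (h b hb).trans (h' b hb) } }

/-- `e : X → Y` is a (Hausdorff) compactification of `X`. -/
structure IsCompactification {X Y : Type*} [TopologicalSpace X] [TopologicalSpace Y]
    (e : X → Y) : Prop where
  compactSpace : CompactSpace Y
  t2Space : T2Space Y
  isDenseEmbedding : IsDenseEmbedding e

/-- `e : X → Y` is the Higson compactification of `X` with respect to `S`: the structure `S` is
compatible with the topology of `X`, and `Y` is a compactification of `X` such that a function
`X → [0, 1]` extends continuously over `Y` if and only if it is continuous and slowly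
oscillating. The Higson corona of `S` is then `corona e`. -/
structure IsHigsonCompactification {X Y : Type*} [TopologicalSpace X] [TopologicalSpace Y]
    (S : SimpleCoarseStructure X) (e : X → Y) : Prop extends IsCompactification e where
  isCompatible : S.IsCompatible
  extends_iff : ∀ g : X → Icc (0 : ℝ) 1,
    (∃ f : Y → Icc (0 : ℝ) 1, Continuous f ∧ ∀ x, f (e x) = g x) ↔
      Continuous g ∧ S.SlowlyOscillating g

/-! ### Gromov hyperbolic spaces -/

/-- A metric space is geodesic if any two points are joined by an isometrically embedded segment. -/
def IsGeodesicSpace (X : Type*) [MetricSpace X] : Prop :=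
  ∀ x y : X, ∃ γ : ℝ → X, γ 0 = x ∧ γ (dist x y) = y ∧
    ∀ s ∈ Icc 0 (dist x y), ∀ t ∈ Icc 0 (dist x y), dist (γ s) (γ t) = |s - t|

section Gromov

variable {X : Type*} [MetricSpace X]

/-- The Gromov product of `x` and `y` with respect to `a`. -/
noncomputable def gromovProduct (a x y : X) : ℝ := (dist x a + dist y a - dist x y) / 2

/-- `X` is Gromov hyperbolic. -/
class IsGromovHyperbolic (X : Type*) [MetricSpace X] : Prop where
  exists_delta : ∃ δ : ℝ, 0 < δ ∧ ∀ x y z a : X,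
    min (gromovProduct a x z) (gromovProduct a z y) - δ / 4 ≤ gromovProduct a x y

theorem gromovProduct_comm (a x y : X) : gromovProduct a x y = gromovProduct a y x := by
  simp only [gromovProduct, dist_comm x y]; ring

theorem gromovProduct_le_dist (a x y : X) : gromovProduct a x y ≤ dist y a := by
  have := dist_triangle x y a
  simp only [gromovProduct]; linarith

theorem gromovProduct_basepoint (a b x y : X) :
    gromovProduct a x y ≤ gromovProduct b x y + dist a b := by
  have h1 := dist_triangle x b a
  have h2 := dist_triangle y b a
  simp only [gromovProduct, dist_comm a b] at *; linarith

/-- Transitivity of divergence of Gromov products, along an arbitrary filter. -/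
theorem tendsto_gromovProduct_trans [IsGromovHyperbolic X] {ι : Type*} {l : Filter ι} {a : X}
    {x y z : ι → X} (h : Tendsto (fun i => gromovProduct a (x i) (y i)) l atTop)
    (h' : Tendsto (fun i => gromovProduct a (y i) (z i)) l atTop) :
    Tendsto (fun i => gromovProduct a (x i) (z i)) l atTop := by
  obtain ⟨δ, _, hδ⟩ := IsGromovHyperbolic.exists_delta (X := X)
  rw [tendsto_atTop] at *
  intro c
  filter_upwards [h (c + δ / 4), h' (c + δ / 4)] with i h1 h2
  have := hδ (x i) (z i) (y i) a
  have := le_min h1 h2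
  linarith

/-- The simple coarse structure of a Gromov hyperbolic space: bounded sets are the sets of finite
diameter, and two simple ends are equivalent if their Gromov products with respect to some base
point tend to infinity. -/
noncomputable def gromovSCS (X : Type*) [MetricSpace X] [IsGromovHyperbolic X] :
    SimpleCoarseStructure X where
  bounded :=
    { sets := {A | Bornology.IsBounded A}
      singleton_mem := fun _ => Bornology.isBounded_singleton
      subset_mem := fun _ _ hC h => hC.subset h
      union_mem := fun _ _ hA hC _ => hA.union hC }
  equiv :=
    { r := fun x y => ∃ p : X, Tendsto (fun n => gromovProduct p (x.1 n) (y.1 n)) atTop atTop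
      iseqv :=
        { refl := by
            rintro ⟨x, hx⟩
            refine ⟨x 0, ?_⟩
            have h : ∀ n, gromovProduct (x 0) (x n) (x n) = dist (x n) (x 0) := by
              intro n; simp only [gromovProduct, dist_self]; ring
            simp only [h]
            rw [tendsto_atTop]
            intro c
            have hfin := hx (Metric.closedBall (x 0) c) Metric.isBounded_closedBall
            rw [← Nat.cofinite_eq_atTop]
            filter_upwards [hfin.compl_mem_cofinite] with n hn
            simp only [mem_compl_iff, mem_ofPred_eq, Metric.mem_closedBall, not_le] at hn
            exact hn.le
          symm := by
            rintro x y ⟨p, h⟩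
            exact ⟨p, by simpa only [gromovProduct_comm p (y.1 _)] using h⟩
          trans := by
            rintro x y z ⟨p, h⟩ ⟨q, h'⟩
            refine ⟨p, tendsto_gromovProduct_trans h ?_⟩
            refine tendsto_atTop_mono (fun n => ?_) (tendsto_atTop_add_const_right _ (-dist q p) h')
            have := gromovProduct_basepoint q p (y.1 n) (z.1 n)
            linarith } }

/-- A sequence converges to infinity if `⟨x i, x j⟩_a → ∞` as `i, j → ∞`. -/
def ConvergesToInfinity (a : X) (x : ℕ → X) : Prop :=
  Tendsto (fun k : ℕ × ℕ => gromovProduct a (x k.1) (x k.2)) atTop atTop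

/-- Sequences `x`, `y` converging to infinity are equivalent if `⟨x i, y j⟩_a → ∞` as
`i, j → ∞`. -/
def gromovBoundarySetoid [IsGromovHyperbolic X] (a : X) :
    Setoid {x : ℕ → X // ConvergesToInfinity a x} where
  r x y := Tendsto (fun k : ℕ × ℕ => gromovProduct a (x.1 k.1) (y.1 k.2)) atTop atTop
  iseqv :=
    { refl := fun x => x.2
      symm := by
        intro x y h
        have hs : Tendsto (Prod.swap : ℕ × ℕ → ℕ × ℕ) atTop atTop := by
          rw [← prod_atTop_atTop_eq]; exact tendsto_prod_swap
        exact (h.comp hs).congr fun k => gromovProduct_comm a _ _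
      trans := by
        intro x y z h h'
        have hk : Tendsto (fun k : ℕ × ℕ => (k.1, k.1)) atTop atTop := by
          rw [← prod_atTop_atTop_eq]; exact tendsto_fst.prodMk tendsto_fst
        have h1 : Tendsto (fun k : ℕ × ℕ => gromovProduct a (x.1 k.1) (y.1 k.1)) atTop atTop :=
          h.comp hk
        exact tendsto_gromovProduct_trans h1 h' }

/-- The (sequential) Gromov boundary, with respect to the base point `a`. -/
def GromovBoundary [IsGromovHyperbolic X] (a : X) : Type _ := Quotient (gromovBoundarySetoid a)

variable [IsGromovHyperbolic X] {a : X}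

/-- The boundary point represented by a sequence converging to infinity. -/
def GromovBoundary.mk (x : {x : ℕ → X // ConvergesToInfinity a x}) : GromovBoundary a :=
  Quotient.mk (gromovBoundarySetoid a) x

/-- The basic neighbourhood `U(p, r)` of `p` in the boundary: all `q` such that
`liminf_{i,j} ⟨x i, y j⟩_a ≥ r` for some representatives `x` of `p` and `y` of `q`.
The lower limit is taken in the extended reals, as it may be infinite. -/
def GromovBoundary.nhd (p : GromovBoundary a) (r : ℝ) : Set (GromovBoundary a) :=
  {q | ∃ x y : {x : ℕ → X // ConvergesToInfinity a x}, mk x = p ∧ mk y = q ∧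
    (r : EReal) ≤
      liminf (fun k : ℕ × ℕ => (gromovProduct a (x.1 k.1) (y.1 k.2) : EReal)) atTop}

/-- The part in `X` of the basic neighbourhood of `p` in `X ∪ ∂X`: all `y` such that
`liminf_i ⟨x i, y⟩_a ≥ r` for some representative `x` of `p`. -/
def GromovBoundary.nhdInside (p : GromovBoundary a) (r : ℝ) : Set X :=
  {y | ∃ x : {x : ℕ → X // ConvergesToInfinity a x}, mk x = p ∧
    (r : EReal) ≤ liminf (fun i : ℕ => (gromovProduct a (x.1 i) y : EReal)) atTop}

theorem GromovBoundary.nhd_anti (p : GromovBoundary a) {r s : ℝ} (h : r ≤ s) :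
    p.nhd s ⊆ p.nhd r := by
  rintro q ⟨x, y, hx, hy, hl⟩
  exact ⟨x, y, hx, hy, (EReal.coe_le_coe_iff.2 h).trans hl⟩

theorem GromovBoundary.nhdInside_anti (p : GromovBoundary a) {r s : ℝ} (h : r ≤ s) :
    p.nhdInside s ⊆ p.nhdInside r := by
  rintro q ⟨x, hx, hl⟩
  exact ⟨x, hx, (EReal.coe_le_coe_iff.2 h).trans hl⟩

/-- The topology of the boundary for which the sets `U(p, r)` form a neighbourhood basis at `p`. -/
instance : TopologicalSpace (GromovBoundary a) where
  IsOpen V := ∀ p ∈ V, ∃ r : ℝ, p.nhd r ⊆ V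
  isOpen_univ := fun _ _ => ⟨0, subset_univ _⟩
  isOpen_inter := by
    rintro V W hV hW p ⟨hp, hp'⟩
    obtain ⟨r, hr⟩ := hV p hp
    obtain ⟨s, hs⟩ := hW p hp'
    exact ⟨max r s, subset_inter ((p.nhd_anti (le_max_left r s)).trans hr)
      ((p.nhd_anti (le_max_right r s)).trans hs)⟩
  isOpen_sUnion := by
    rintro 𝒱 h p ⟨V, hV, hp⟩
    obtain ⟨r, hr⟩ := h V hV p hp
    exact ⟨r, hr.trans (subset_sUnion_of_mem hV)⟩

/-- The set `X ∪ ∂X` underlying the Gromov compactification (a disjoint union). -/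
inductive GromovCompactification (a : X) : Type _
  | inside (x : X) : GromovCompactification a
  | ideal (p : GromovBoundary a) : GromovCompactification a

/-- The basic neighbourhood `U'(p, r)` of a boundary point in `X ∪ ∂X`. -/
def GromovCompactification.nhd (p : GromovBoundary a) (r : ℝ) : Set (GromovCompactification a) :=
  ideal '' p.nhd r ∪ inside '' p.nhdInside r

theorem GromovCompactification.nhd_anti (p : GromovBoundary a) {r s : ℝ} (h : r ≤ s) :
    nhd p s ⊆ nhd p r :=
  union_subset_union (image_mono (p.nhd_anti h)) (image_mono (p.nhdInside_anti h))

/-- The topology of `X ∪ ∂X`: neighbourhoods of points of `X` are those of the metric topology, and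
the sets `U'(p, r)` form a neighbourhood basis at a boundary point `p`. -/
instance : TopologicalSpace (GromovCompactification a) where
  IsOpen V := IsOpen {x : X | GromovCompactification.inside x ∈ V} ∧
    ∀ p : GromovBoundary a, GromovCompactification.ideal p ∈ V →
      ∃ r : ℝ, GromovCompactification.nhd p r ⊆ V
  isOpen_univ := ⟨isOpen_univ, fun _ _ => ⟨0, subset_univ _⟩⟩
  isOpen_inter := by
    rintro V W ⟨hV', hV⟩ ⟨hW', hW⟩
    refine ⟨hV'.inter hW', ?_⟩
    rintro p ⟨hp, hp'⟩
    obtain ⟨r, hr⟩ := hV p hp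
    obtain ⟨s, hs⟩ := hW p hp'
    exact ⟨max r s, subset_inter
      ((GromovCompactification.nhd_anti p (le_max_left r s)).trans hr)
      ((GromovCompactification.nhd_anti p (le_max_right r s)).trans hs)⟩
  isOpen_sUnion := by
    intro 𝒱 h
    constructor
    · have : {x : X | GromovCompactification.inside x ∈ ⋃₀ 𝒱} =
          ⋃ V ∈ 𝒱, {x : X | (GromovCompactification.inside x : GromovCompactification a) ∈ V} := by
        ext x; simp
      rw [this]
      exact isOpen_biUnion fun V hV => (h V hV).1
    · rintro p ⟨V, hV, hp⟩
      obtain ⟨r, hr⟩ := (h V hV).2 p hp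
      exact ⟨r, hr.trans (subset_sUnion_of_mem hV)⟩

theorem GromovBoundary.exists_notMem_nhd {p q : GromovBoundary a} (h : p ≠ q) :
    ∃ r : ℝ, p ∉ q.nhd r := by
  obtain ⟨v, rfl⟩ := Quotient.exists_rep p
  obtain ⟨u, rfl⟩ := Quotient.exists_rep q
  by_contra! hall
  apply h
  refine (Quotient.sound (s := gromovBoundarySetoid a) ?_).symm
  change Tendsto (fun k : ℕ × ℕ => gromovProduct a (u.1 k.1) (v.1 k.2)) atTop atTop
  obtain ⟨δ, hδ0, hδ⟩ := IsGromovHyperbolic.exists_delta (X := X)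
  rw [tendsto_atTop]
  intro c
  obtain ⟨x, y, hx, hy, hl⟩ := hall (c + δ)
  have hux : Tendsto (fun k : ℕ × ℕ => gromovProduct a (u.1 k.1) (x.1 k.2)) atTop atTop :=
    Quotient.exact (s := gromovBoundarySetoid a) hx.symm
  have hyv : Tendsto (fun k : ℕ × ℕ => gromovProduct a (y.1 k.1) (v.1 k.2)) atTop atTop :=
    Quotient.exact (s := gromovBoundarySetoid a) hy
  have hd : Tendsto (fun k : ℕ × ℕ => (k.1, k.1)) atTop atTop := by
    rw [← prod_atTop_atTop_eq]; exact tendsto_fst.prodMk tendsto_fst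
  have hd' : Tendsto (fun k : ℕ × ℕ => (k.2, k.2)) atTop atTop := by
    rw [← prod_atTop_atTop_eq]; exact tendsto_snd.prodMk tendsto_snd
  have hl' := (le_liminf_iff).1 hl ((c + δ / 2 : ℝ) : EReal)
    (EReal.coe_lt_coe_iff.2 (by linarith))
  filter_upwards [hl', (tendsto_atTop.1 (hux.comp hd)) (c + δ / 2),
    (tendsto_atTop.1 (hyv.comp hd')) (c + δ / 2)] with k h1 h2 h3
  have h1 : c + δ / 2 < gromovProduct a (x.1 k.1) (y.1 k.2) := EReal.coe_lt_coe_iff.1 h1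
  simp only [Function.comp_apply] at h2 h3
  have e1 := hδ (u.1 k.1) (y.1 k.2) (x.1 k.1) a
  have e2 := hδ (u.1 k.1) (v.1 k.2) (y.1 k.2) a
  have e3 := le_min h2 h1.le
  have e4 := le_min (show c + δ / 4 ≤ gromovProduct a (u.1 k.1) (y.1 k.2) by linarith)
    (show c + δ / 4 ≤ gromovProduct a (y.1 k.2) (v.1 k.2) by linarith)
  linarith

theorem GromovBoundary.exists_notMem_nhdInside (p : GromovBoundary a) (y : X) :
    ∃ r : ℝ, y ∉ p.nhdInside r := by
  refine ⟨dist y a + 1, ?_⟩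
  rintro ⟨x, -, hl⟩
  have h := (le_liminf_iff).1 hl ((dist y a : ℝ) : EReal)
    (EReal.coe_lt_coe_iff.2 (by linarith))
  obtain ⟨i, hi⟩ := h.exists
  exact absurd (EReal.coe_lt_coe_iff.1 hi) (not_lt.2 (gromovProduct_le_dist a _ y))

/-- Points of `X ∪ ∂X` are closed. -/
instance : T1Space (GromovCompactification a) where
  t1 := by
    intro z
    rw [← isOpen_compl_iff]
    cases z with
    | inside y =>
      constructor
      · have : {x : X | (GromovCompactification.inside x : GromovCompactification a) ∈
            ({GromovCompactification.inside y}ᶜ : Set _)} = {y}ᶜ := by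
          ext x; simp
        rw [this]; exact isOpen_compl_singleton
      · intro p _
        obtain ⟨r, hr⟩ := p.exists_notMem_nhdInside y
        refine ⟨r, ?_⟩
        rintro _ (⟨q, -, rfl⟩ | ⟨w, hw, rfl⟩)
        · simp
        · simp only [mem_compl_iff, mem_singleton_iff, GromovCompactification.inside.injEq]
          rintro rfl; exact hr hw
    | ideal q =>
      constructor
      · have : {x : X | (GromovCompactification.inside x : GromovCompactification a) ∈
            ({GromovCompactification.ideal q}ᶜ : Set _)} = univ := by
          ext x; simp
        rw [this]; exact isOpen_univ
      · intro p hp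
        have hpq : q ≠ p := by rintro rfl; exact hp rfl
        obtain ⟨r, hr⟩ := GromovBoundary.exists_notMem_nhd hpq
        refine ⟨r, ?_⟩
        rintro _ (⟨w, hw, rfl⟩ | ⟨w, -, rfl⟩)
        · simp only [mem_compl_iff, mem_singleton_iff, GromovCompactification.ideal.injEq]
          rintro rfl; exact hr hw
        · simp

end Gromov

/-! Everything is read off one coarse relation, `Near r ξ η`: on fixed representing sequences, the
Gromov product of two points of `X ∪ ∂X` is eventually at least `r`. Hyperbolicity makes it
transitive up to an additive constant (`exists_near_trans`), and changing representatives also costs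
only a constant. Hence the sets `{ξ | Near r (ideal p) ξ}` form a neighbourhood basis at `p`
(`nhds_ideal_hasBasis`). For a family in `X` tending to a boundary point, a second family tends to
the same point iff the mutual Gromov products diverge.

Compactness rests on `exists_finite_near`: a geodesic from `a` to a far point leaves the ball of
radius `n` at a point whose Gromov product with the far one is `n`, and by properness finitely many
centres serve for all such points. An ultrafilter containing no ball selects one centre for each
`n`; these converge to infinity, and their class is its limit.

Equivalent simple ends thus have the same boundary limits along every ultrafilter, which gives the
induced structure and the slow oscillation of continuous functions. Conversely, a slowly oscillating
function is Cauchy at each boundary point, so it extends. Uniqueness of the Higson compactification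
holds because functions to `[0, 1]` separate the points of a compact Hausdorff space. -/

theorem gromovProduct_le_add_dist {X : Type*} [MetricSpace X] (a x y z : X) :
    gromovProduct a x y ≤ gromovProduct a x z + dist y z := by
  have h1 := dist_triangle y z a
  have h2 := dist_triangle x y z
  simp only [gromovProduct]; linarith

theorem tendsto_prod_atTop {f g : ℕ × ℕ → ℕ} (hf : Tendsto f atTop atTop)
    (hg : Tendsto g atTop atTop) : Tendsto (fun k => (f k, g k)) atTop atTop := by
  rw [← prod_atTop_atTop_eq] at *
  exact hf.prodMk hg

theorem tendsto_fst_atTop : Tendsto (Prod.fst : ℕ × ℕ → ℕ) atTop atTop := by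
  rw [← prod_atTop_atTop_eq]; exact tendsto_fst

theorem tendsto_snd_atTop : Tendsto (Prod.snd : ℕ × ℕ → ℕ) atTop atTop := by
  rw [← prod_atTop_atTop_eq]; exact tendsto_snd

theorem tendsto_diag_atTop : Tendsto (fun i : ℕ => (i, i)) atTop atTop := by
  rw [← prod_atTop_atTop_eq]; exact tendsto_id.prodMk tendsto_id

/-! ### Coarse Gromov products on `X ∪ ∂X` -/

namespace GromovCompactification

variable {X : Type*} [MetricSpace X] [IsGromovHyperbolic X] {a : X}

/-- A sequence in `X` representing a point of `X ∪ ∂X`; it is constant for points of `X`. -/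
noncomputable def approx : GromovCompactification a → ℕ → X
  | inside x => fun _ => x
  | ideal p => (Quotient.out (s := gromovBoundarySetoid a) p).1

/-- The Gromov product of two points of `X ∪ ∂X`, computed on the chosen representing sequences,
is at least `r` from some index on. -/
def Near (r : ℝ) (ξ η : GromovCompactification a) : Prop :=
  ∀ᶠ k : ℕ × ℕ in atTop, r ≤ gromovProduct a (ξ.approx k.1) (η.approx k.2)

theorem Near.mono {r s : ℝ} {ξ η : GromovCompactification a} (h : Near r ξ η) (hs : s ≤ r) :
    Near s ξ η := by
  filter_upwards [h] with k hk using hs.trans hk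

theorem Near.symm {r : ℝ} {ξ η : GromovCompactification a} (h : Near r ξ η) : Near r η ξ := by
  filter_upwards [(tendsto_prod_atTop tendsto_snd_atTop tendsto_fst_atTop).eventually h] with k hk
  rwa [gromovProduct_comm]

theorem near_inside_inside {r : ℝ} {x y : X} :
    Near r (inside x : GromovCompactification a) (inside y) ↔ r ≤ gromovProduct a x y := by
  simp only [Near, approx, eventually_const]

theorem near_self_ideal (r : ℝ) (p : GromovBoundary a) : Near r (ideal p) (ideal p) :=
  tendsto_atTop.1 (Quotient.out (s := gromovBoundarySetoid a) p).2 r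

theorem Near.le_dist {r : ℝ} {ξ : GromovCompactification a} {x : X} (h : Near r ξ (inside x)) :
    r ≤ dist x a := by
  obtain ⟨k, hk⟩ := Eventually.exists h
  exact hk.trans (gromovProduct_le_dist a _ _)

theorem Near.inside_of_dist_le {r s : ℝ} {ξ : GromovCompactification a} {x y : X}
    (h : Near r ξ (inside x)) (hd : dist x y ≤ s) : Near (r - s) ξ (inside y) := by
  filter_upwards [h] with k hk
  have h1 : r ≤ gromovProduct a (ξ.approx k.1) x := hk
  have h2 := gromovProduct_le_add_dist a (ξ.approx k.1) x y
  change r - s ≤ gromovProduct a (ξ.approx k.1) y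
  linarith

theorem exists_near_trans (a : X) : ∃ δ : ℝ, 0 < δ ∧ ∀ (r : ℝ) (ξ ζ η : GromovCompactification a),
    Near r ξ ζ → Near r ζ η → Near (r - δ) ξ η := by
  obtain ⟨δ, hδ0, hδ⟩ := IsGromovHyperbolic.exists_delta (X := X)
  refine ⟨δ, hδ0, fun r ξ ζ η h h' => ?_⟩
  -- The middle point is sampled at the second index, so the second hypothesis is needed along the
  -- diagonal pairs `(k.2, k.2)`.
  filter_upwards [h, (tendsto_prod_atTop tendsto_snd_atTop tendsto_snd_atTop).eventually h']
    with k h1 h2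
  have := hδ (ξ.approx k.1) (η.approx k.2) (ζ.approx k.2) a
  have := le_min h1 h2
  linarith

theorem mk_out (p : GromovBoundary a) :
    GromovBoundary.mk (Quotient.out (s := gromovBoundarySetoid a) p) = p :=
  Quotient.out_eq (s := gromovBoundarySetoid a) p

theorem eq_of_forall_near {p q : GromovBoundary a} (h : ∀ r, Near r (ideal p) (ideal q)) :
    p = q := by
  rw [← mk_out p, ← mk_out q]
  exact Quotient.sound (s := gromovBoundarySetoid a) (tendsto_atTop.2 h)

/-- Lower bounds for the Gromov products with a representative `x` of a boundary point pass to the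
chosen representative, up to a uniform constant. -/
theorem near_mk_of_eventually {x : {x : ℕ → X // ConvergesToInfinity a x}} {δ : ℝ} (hδ0 : 0 < δ)
    (hδ : ∀ x y z b : X,
      min (gromovProduct b x z) (gromovProduct b z y) - δ / 4 ≤ gromovProduct b x y)
    {r : ℝ} {η : ℕ → X}
    (h : ∀ᶠ k : ℕ × ℕ in atTop, r ≤ gromovProduct a (x.1 k.1) (η k.2)) :
    ∀ᶠ k : ℕ × ℕ in atTop,
      r - δ ≤ gromovProduct a (approx (ideal (GromovBoundary.mk x)) k.1) (η k.2) := by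
  have hx := tendsto_atTop.1 (Quotient.exact (s := gromovBoundarySetoid a)
    (mk_out (GromovBoundary.mk x))) r
  filter_upwards [(tendsto_prod_atTop tendsto_fst_atTop tendsto_fst_atTop).eventually hx, h]
    with k h1 h2
  have := hδ (approx (ideal (GromovBoundary.mk x)) k.1) (η k.2) (x.1 k.1) a
  have := le_min h1 h2
  simp only [approx] at *
  linarith

/-- Together with `mem_nhd_of_near` this interleaves the two families of neighbourhoods. The
constant does not depend on `p`, `r` or the representatives witnessing membership. -/
theorem near_of_mem_nhd (a : X) : ∃ C : ℝ, 0 < C ∧ ∀ (p : GromovBoundary a) (r : ℝ),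
    ∀ ξ ∈ nhd p r, Near (r - C) (ideal p) ξ := by
  obtain ⟨δ, hδ0, hδ⟩ := IsGromovHyperbolic.exists_delta (X := X)
  -- One `δ` turns the lower limit into an eventual bound; the other two pay for replacing the
  -- representatives of the two boundary points.
  refine ⟨3 * δ, by positivity, ?_⟩
  rintro p r _ (⟨q, ⟨x, y, rfl, rfl, hl⟩, rfl⟩ | ⟨y, ⟨x, rfl, hl⟩, rfl⟩)
  · have h := (le_liminf_iff).1 hl ((r - δ : ℝ) : EReal) (EReal.coe_lt_coe_iff.2 (by linarith))
    have h1 := near_mk_of_eventually (x := x) (η := y.1) (r := r - δ) hδ0 hδ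
      (h.mono fun k hk => (EReal.coe_lt_coe_iff.1 hk).le)
    have h2 := near_mk_of_eventually (x := y) (r := r - δ - δ) hδ0 hδ
      (((tendsto_prod_atTop tendsto_snd_atTop tendsto_fst_atTop).eventually h1).mono fun k hk => by
        rwa [gromovProduct_comm] at hk)
    refine Near.symm (Eventually.mono h2 fun k hk => ?_)
    linarith
  · have h := (le_liminf_iff).1 hl ((r - δ : ℝ) : EReal) (EReal.coe_lt_coe_iff.2 (by linarith))
    have h1 := near_mk_of_eventually (x := x) (η := fun _ => y) (r := r - δ) hδ0 hδ
      ((tendsto_fst_atTop.eventually h).mono fun k hk => (EReal.coe_lt_coe_iff.1 hk).le)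
    refine Eventually.mono h1 fun k hk => ?_
    simp only [approx] at hk ⊢
    linarith

/-- Nothing is lost here: `nhd` asks only for some representatives, and the chosen ones qualify. -/
theorem mem_nhd_of_near {p : GromovBoundary a} {r : ℝ} {ξ : GromovCompactification a}
    (h : Near r (ideal p) ξ) : ξ ∈ nhd p r := by
  cases ξ with
  | ideal q =>
    refine Or.inl ⟨q, ⟨_, _, mk_out p, mk_out q, ?_⟩, rfl⟩
    exact le_liminf_of_le (by isBoundedDefault)
      (Eventually.mono h fun k hk => EReal.coe_le_coe_iff.2 hk)
  | inside y =>
    refine Or.inr ⟨y, ⟨_, mk_out p, ?_⟩, rfl⟩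
    exact le_liminf_of_le (by isBoundedDefault)
      ((tendsto_diag_atTop.eventually h).mono fun k hk => EReal.coe_le_coe_iff.2 hk)

/-! ### The topology of `X ∪ ∂X` -/

theorem isOpen_iff_near {V : Set (GromovCompactification a)} :
    IsOpen V ↔ IsOpen {x : X | (inside x : GromovCompactification a) ∈ V} ∧
      ∀ p : GromovBoundary a, ideal p ∈ V → ∃ r : ℝ, {ξ | Near r (ideal p) ξ} ⊆ V := by
  refine and_congr_right fun _ => forall₂_congr fun p _ => ?_
  constructor
  · rintro ⟨r, hr⟩
    exact ⟨r, fun ξ hξ => hr (mem_nhd_of_near hξ)⟩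
  · rintro ⟨r, hr⟩
    obtain ⟨C, -, hC⟩ := near_of_mem_nhd a
    refine ⟨r + C, fun ξ hξ => hr ?_⟩
    simpa using hC p _ ξ hξ

/-- The topology prescribes only the open sets, so it remains to see that each of these sets
contains an open set around `p`. Coarse transitivity provides it. -/
theorem nhds_ideal_hasBasis (p : GromovBoundary a) :
    (𝓝 (ideal p : GromovCompactification a)).HasBasis (fun _ : ℝ => True)
      fun r => {ξ | Near r (ideal p) ξ} := by
  refine ⟨fun S => ?_⟩
  simp only [true_and]
  constructor
  · intro hS
    obtain ⟨V, hVS, hV, hp⟩ := mem_nhds_iff.1 hS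
    obtain ⟨r, hr⟩ := (isOpen_iff_near.1 hV).2 p hp
    exact ⟨r, hr.trans hVS⟩
  · rintro ⟨r, hr⟩
    obtain ⟨δ, hδ0, hδ⟩ := exists_near_trans a
    refine mem_nhds_iff.2 ⟨inside '' interior {x | inside x ∈ S} ∪
      ideal '' {q | ∃ t, {ξ | Near t (ideal q) ξ} ⊆ S}, ?_, ?_, Or.inr ⟨p, ⟨r, hr⟩, rfl⟩⟩
    · rintro _ (⟨x, hx, rfl⟩ | ⟨q, ⟨t, ht⟩, rfl⟩)
      · exact (interior_subset hx : x ∈ {x | inside x ∈ S})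
      · exact ht (near_self_ideal t q)
    · refine isOpen_iff_near.2 ⟨?_, ?_⟩
      · have : {x : X | (inside x : GromovCompactification a) ∈
            inside '' interior {x | inside x ∈ S} ∪
              ideal '' {q | ∃ t, {ξ | Near t (ideal q) ξ} ⊆ S}} =
            interior {x | (inside x : GromovCompactification a) ∈ S} := by
          ext x; simp
        rw [this]; exact isOpen_interior
      · rintro q (⟨x, -, hx⟩ | ⟨q', ⟨t, ht⟩, hq⟩)
        · cases hx
        · cases hq
          -- The `1` leaves room for a unit ball around a point of `X`, the `δ` for one use of
          -- transitivity at a boundary point.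
          refine ⟨t + δ + 1, ?_⟩
          rintro (x | q') hq'
          · refine Or.inl ⟨x, ?_, rfl⟩
            rw [mem_interior_iff_mem_nhds]
            filter_upwards [Metric.closedBall_mem_nhds x one_pos] with y hy
            refine ht ((Near.inside_of_dist_le (s := 1) hq' ?_).mono (s := t) (by linarith))
            rw [dist_comm]; exact hy
          · refine Or.inr ⟨q', ⟨t + δ + 1, fun ξ hξ => ht ?_⟩, rfl⟩
            exact (hδ _ _ _ _ hq' hξ).mono (by linarith)

theorem isOpenEmbedding_inside :
    IsOpenEmbedding (inside : X → GromovCompactification a) := by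
  refine IsOpenEmbedding.of_continuous_injective_isOpenMap ?_ (fun x y h => by cases h; rfl) ?_
  · exact ⟨fun V hV => (isOpen_iff_near.1 hV).1⟩
  · intro U hU
    refine isOpen_iff_near.2 ⟨?_, ?_⟩
    · simpa using hU
    · rintro p ⟨x, -, hx⟩
      cases hx

theorem corona_inside : corona (inside : X → GromovCompactification a) = range ideal := by
  ext ξ
  cases ξ <;> simp [corona]

theorem isEmbedding_ideal :
    IsEmbedding (ideal : GromovBoundary a → GromovCompactification a) := by
  refine ⟨⟨le_antisymm ?_ ?_⟩, fun p q h => by cases h; rfl⟩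
  · rintro _ ⟨V, hV, rfl⟩
    intro p hp
    obtain ⟨r, hr⟩ := hV.2 p hp
    exact ⟨r, fun q hq => hr (Or.inl ⟨q, hq, rfl⟩)⟩
  · intro V hV
    -- Adjoining all of `X` makes the inside part of every basic neighbourhood harmless.
    refine ⟨ideal '' V ∪ range inside, ⟨by simp, ?_⟩, ?_⟩
    · rintro p (⟨q, hq, h⟩ | ⟨x, h⟩)
      · cases h
        obtain ⟨r, hr⟩ := hV p hq
        exact ⟨r, union_subset_union (image_mono hr) (image_subset_range _ _)⟩
      · cases h
    · ext p; simp

instance : T2Space (GromovCompactification a) := by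
  obtain ⟨δ, hδ0, hδ⟩ := exists_near_trans a
  have hmix : ∀ (x : X) (p : GromovBoundary a),
      Disjoint (𝓝 (inside x : GromovCompactification a)) (𝓝 (ideal p)) := by
    intro x p
    -- A point of the unit ball is at distance at most `dist x a + 1` from `a`, too little to be
    -- near `p` at level `dist x a + 2`.
    refine Filter.disjoint_iff.2 ⟨_, isOpenEmbedding_inside.isOpenMap.image_mem_nhds
      (Metric.closedBall_mem_nhds x one_pos), _,
      (nhds_ideal_hasBasis p).mem_of_mem (i := dist x a + 2) trivial, ?_⟩
    rw [Set.disjoint_left]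
    rintro _ ⟨y, hy, rfl⟩ h
    have h1 := Near.le_dist h
    have h2 := dist_triangle y x a
    rw [Metric.mem_closedBall] at hy
    linarith
  rw [t2Space_iff_disjoint_nhds]
  rintro (x | p) (y | q) hne
  · rw [← isOpenEmbedding_inside.map_nhds_eq, ← isOpenEmbedding_inside.map_nhds_eq,
      disjoint_map isOpenEmbedding_inside.injective, disjoint_nhds_nhds]
    rintro rfl; exact hne rfl
  · exact hmix x q
  · exact (hmix y p).symm
  · have : ∃ r, ¬ Near r (ideal p) (ideal q) := by
      by_contra! h
      exact hne (congrArg ideal (eq_of_forall_near h))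
    obtain ⟨r, hr⟩ := this
    refine Filter.disjoint_iff.2 ⟨_, (nhds_ideal_hasBasis p).mem_of_mem (i := r + δ) trivial, _,
      (nhds_ideal_hasBasis q).mem_of_mem (i := r + δ) trivial, ?_⟩
    rw [Set.disjoint_left]
    intro ξ h1 h2
    exact hr ((hδ _ _ _ _ h1 h2.symm).mono (by linarith))

/-- With compactness this gives convergent subsequences, used in `equiv_of_closure_eq`. -/
instance : FirstCountableTopology (GromovCompactification a) := by
  refine ⟨?_⟩
  rintro (x | p)
  · rw [← isOpenEmbedding_inside.map_nhds_eq]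
    infer_instance
  · refine HasCountableBasis.isCountablyGenerated (p := fun _ : ℕ => True)
      (s := fun n : ℕ => {ξ | Near (n : ℝ) (ideal p) ξ}) ⟨?_, to_countable _⟩
    refine (nhds_ideal_hasBasis p).to_hasBasis (fun r _ => ?_) fun n _ => ⟨n, trivial, le_rfl⟩
    obtain ⟨n, hn⟩ := exists_nat_ge r
    exact ⟨n, trivial, fun ξ hξ => Near.mono hξ hn⟩

theorem isDenseEmbedding_inside :
    IsDenseEmbedding (inside : X → GromovCompactification a) := by
  refine ⟨⟨isOpenEmbedding_inside.isInducing, ?_⟩, isOpenEmbedding_inside.injective⟩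
  rintro (x | p)
  · exact subset_closure (mem_range_self x)
  · refine (mem_closure_iff_nhds_basis (nhds_ideal_hasBasis p)).2 fun r _ => ?_
    obtain ⟨⟨m, n⟩, hmn⟩ := eventually_atTop.1 (near_self_ideal r p)
    refine ⟨inside (approx (ideal p) n), mem_range_self _, ?_⟩
    refine eventually_atTop.2 ⟨(m, n), fun k hk => ?_⟩
    exact hmn (k.1, n) ⟨hk.1, le_rfl⟩

end GromovCompactification

/-! ### Compactness -/

/-- The point at distance `R` from `a` on a geodesic to `x` has Gromov product exactly `R` with `x`.
Moving it to a centre of a finite cover of the ball by unit balls costs at most `1`. -/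
theorem exists_finite_gromovProduct_net {X : Type*} [MetricSpace X] [ProperSpace X]
    (hgeo : IsGeodesicSpace X) (a : X) {R : ℝ}
    (hR : 0 ≤ R) :
    ∃ F : Set X, F.Finite ∧ ∀ x, R ≤ dist x a → ∃ z ∈ F, R - 1 ≤ gromovProduct a x z := by
  obtain ⟨F, -, hF, hcov⟩ :=
    (isCompact_closedBall a R).finite_cover_balls one_pos
  refine ⟨F, hF, fun x hx => ?_⟩
  obtain ⟨γ, h0, h1, hγ⟩ := hgeo a x
  rw [dist_comm] at hx
  have hwa : dist (γ R) a = R := by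
    rw [← h0, hγ R ⟨hR, hx⟩ 0 ⟨le_rfl, dist_nonneg⟩, sub_zero, abs_of_nonneg hR]
  have hwx : dist (γ R) x = dist a x - R := by
    conv_lhs => rw [← h1]
    rw [hγ R ⟨hR, hx⟩ _ ⟨dist_nonneg, le_rfl⟩, abs_sub_comm, abs_of_nonneg (by linarith)]
  obtain ⟨z, hz, hwz⟩ := mem_iUnion₂.1 (hcov (Metric.mem_closedBall.2 hwa.le))
  refine ⟨z, hz, ?_⟩
  have h2 := gromovProduct_le_add_dist a x (γ R) z
  rw [Metric.mem_ball] at hwz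
  have h3 : gromovProduct a x (γ R) = R := by
    rw [gromovProduct, hwa, dist_comm x (γ R), hwx, dist_comm x a]; ring
  linarith

theorem tendsto_gromovProduct_basepoint {X : Type*} [MetricSpace X] {ι : Type*} {l : Filter ι}
    {x y : ι → X} {b : X}
    (h : Tendsto (fun i => gromovProduct b (x i) (y i)) l atTop) (a : X) :
    Tendsto (fun i => gromovProduct a (x i) (y i)) l atTop := by
  refine tendsto_atTop_mono (fun i => ?_) (tendsto_atTop_add_const_right _ (-dist b a) h)
  have := gromovProduct_basepoint b a (x i) (y i)
  linarith

namespace GromovCompactification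

variable {X : Type*} [MetricSpace X] [IsGromovHyperbolic X] {a : X}

theorem exists_finite_near [ProperSpace X] (hgeo : IsGeodesicSpace X) (a : X) :
    ∃ c : ℝ, ∀ n : ℕ, ∃ F : Set X, F.Finite ∧ ∀ ξ : GromovCompactification a,
      ξ ∉ inside '' Metric.closedBall a n → ∃ z ∈ F, Near (n - c) ξ (inside z) := by
  obtain ⟨δ, hδ0, hδ⟩ := exists_near_trans a
  refine ⟨1 + δ, fun n => ?_⟩
  obtain ⟨F, hF, hnet⟩ := exists_finite_gromovProduct_net hgeo a n.cast_nonneg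
  refine ⟨F, hF, ?_⟩
  rintro (x | q) hξ
  · have hx : (n : ℝ) ≤ dist x a := by
      by_contra! h
      exact hξ ⟨x, Metric.mem_closedBall.2 h.le, rfl⟩
    obtain ⟨z, hz, h⟩ := hnet x hx
    exact ⟨z, hz, near_inside_inside.2 (by linarith)⟩
  -- A boundary point is replaced by a far term of its representing sequence, to which the net
  -- applies.
  · obtain ⟨⟨i, j⟩, hij⟩ := eventually_atTop.1 (near_self_ideal (n : ℝ) q)
    set x := approx (ideal q) j with hxdef
    have hqx : Near (n : ℝ) (ideal q) (inside x) :=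
      eventually_atTop.2 ⟨(i, j), fun k hk => hij (k.1, j) ⟨hk.1, le_rfl⟩⟩
    obtain ⟨z, hz, h⟩ := hnet x hqx.le_dist
    refine ⟨z, hz, ?_⟩
    have := hδ (n - 1) _ _ _ (hqx.mono (by linarith)) (near_inside_inside.2 h)
    exact this.mono (by linarith)

theorem compactSpace [ProperSpace X] (hgeo : IsGeodesicSpace X) (a : X) :
    CompactSpace (GromovCompactification a) := by
  refine ⟨isCompact_iff_ultrafilter_le_nhds.2 fun 𝓕 _ => ?_⟩
  by_cases hball : ∃ n : ℕ, inside '' Metric.closedBall a (n : ℝ) ∈ 𝓕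
  · obtain ⟨n, hn⟩ := hball
    obtain ⟨ξ, -, hξ⟩ := ((isCompact_closedBall a (n : ℝ)).image
      isOpenEmbedding_inside.continuous).ultrafilter_le_nhds 𝓕 (le_principal_iff.2 hn)
    exact ⟨ξ, mem_univ _, hξ⟩
  push Not at hball
  obtain ⟨c, hc⟩ := exists_finite_near hgeo a
  have hz : ∀ n : ℕ, ∃ z : X, {ξ | Near ((n : ℝ) - c) ξ (inside z)} ∈ 𝓕 := by
    intro n
    obtain ⟨F, hF, hnear⟩ := hc n
    have hmem : (⋃ z ∈ F, {ξ : GromovCompactification a | Near ((n : ℝ) - c) ξ (inside z)}) ∈ 𝓕 := by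
      refine mem_of_superset (Ultrafilter.compl_mem_iff_notMem.2 (hball n)) fun ξ hξ => ?_
      obtain ⟨z, hz, h⟩ := hnear ξ hξ
      exact mem_biUnion hz h
    obtain ⟨z, -, h⟩ := (Ultrafilter.finite_biUnion_mem_iff hF).1 hmem
    exact ⟨z, h⟩
  choose z hz using hz
  obtain ⟨δ, hδ0, hδ⟩ := exists_near_trans a
  -- Two members of the ultrafilter intersect, and a common point is near both centres.
  have hzz : ∀ N m n : ℕ, N ≤ m → N ≤ n →
      (N : ℝ) - c - δ ≤ gromovProduct a (z m) (z n) := by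
    intro N m n hm hn
    obtain ⟨ξ, h1, h2⟩ := 𝓕.nonempty_of_mem (inter_mem (hz m) (hz n))
    have hm' : (N : ℝ) ≤ m := Nat.cast_le.2 hm
    have hn' : (N : ℝ) ≤ n := Nat.cast_le.2 hn
    exact near_inside_inside.1 (hδ (N - c) _ ξ _ (Near.mono h1 (by linarith)).symm
      (Near.mono h2 (by linarith)))
  have hconv : ConvergesToInfinity a z := by
    refine tendsto_atTop.2 fun r => ?_
    obtain ⟨N, hN⟩ := exists_nat_ge (r + c + δ)
    refine eventually_atTop.2 ⟨(N, N), fun k hk => ?_⟩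
    have := hzz N k.1 k.2 hk.1 hk.2
    linarith
  refine ⟨ideal (GromovBoundary.mk ⟨z, hconv⟩), mem_univ _, ?_⟩
  refine (nhds_ideal_hasBasis _).ge_iff.2 fun r _ => ?_
  obtain ⟨δ', hδ0', hδ'⟩ := IsGromovHyperbolic.exists_delta (X := X)
  -- The losses are `c` from the net, one `δ` from `hzz`, `δ'` from the choice of representative,
  -- and a last `δ` from passing through `z N`.
  obtain ⟨N, hN⟩ := exists_nat_ge (r + c + δ + δ + δ')
  have hpN : Near (N - c - δ - δ') (ideal (GromovBoundary.mk ⟨z, hconv⟩)) (inside (z N)) := by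
    refine near_mk_of_eventually hδ0' hδ' (η := fun _ => z N) ?_
    exact eventually_atTop.2 ⟨(N, N), fun k hk => hzz N k.1 N hk.1 le_rfl⟩
  refine mem_of_superset (hz N) fun ξ hξ => ?_
  exact (hδ _ _ _ _ hpN (Near.mono (Near.symm hξ) (by linarith))).mono (by linarith)

/-! ### Convergence to boundary points and the Higson property -/

section Filter

variable {ι : Type*} {l : Filter ι} {x y : ι → X} {p : GromovBoundary a}

theorem tendsto_ideal_of_gromovProduct
    (hx : Tendsto (fun i => (inside (x i) : GromovCompactification a)) l (𝓝 (ideal p)))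
    (h : Tendsto (fun i => gromovProduct a (x i) (y i)) l atTop) :
    Tendsto (fun i => (inside (y i) : GromovCompactification a)) l (𝓝 (ideal p)) := by
  obtain ⟨δ, hδ0, hδ⟩ := exists_near_trans a
  refine (nhds_ideal_hasBasis p).tendsto_right_iff.2 fun r _ => ?_
  filter_upwards [(nhds_ideal_hasBasis p).tendsto_right_iff.1 hx (r + δ) trivial,
    tendsto_atTop.1 h (r + δ)] with i h1 h2
  exact (hδ _ _ _ _ h1 (near_inside_inside.2 h2)).mono (by linarith)

theorem tendsto_gromovProduct_of_ideal
    (hx : Tendsto (fun i => (inside (x i) : GromovCompactification a)) l (𝓝 (ideal p)))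
    (hy : Tendsto (fun i => (inside (y i) : GromovCompactification a)) l (𝓝 (ideal p))) :
    Tendsto (fun i => gromovProduct a (x i) (y i)) l atTop := by
  obtain ⟨δ, hδ0, hδ⟩ := exists_near_trans a
  refine tendsto_atTop.2 fun r => ?_
  filter_upwards [(nhds_ideal_hasBasis p).tendsto_right_iff.1 hx (r + δ) trivial,
    (nhds_ideal_hasBasis p).tendsto_right_iff.1 hy (r + δ) trivial] with i h1 h2
  have := near_inside_inside.1 (hδ _ _ _ _ (Near.symm h1) h2)
  linarith

theorem exists_eq_ideal_of_tendsto [l.NeBot] {ξ : GromovCompactification a}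
    (hx : Tendsto (fun i => (inside (x i) : GromovCompactification a)) l (𝓝 ξ))
    (h : Tendsto (fun i => dist (x i) a) l atTop) : ∃ p, ξ = ideal p := by
  cases ξ with
  | ideal p => exact ⟨p, rfl⟩
  | inside z =>
    have hz : Tendsto x l (𝓝 z) := isOpenEmbedding_inside.isInducing.tendsto_nhds_iff.2 hx
    exact absurd h (not_tendsto_atTop_of_tendsto_nhds (hz.dist tendsto_const_nhds))

end Filter

theorem gromovSCS_equiv_iff (a : X) {x y : (gromovSCS X).bounded.SimpleEnd} :
    (gromovSCS X).equiv x y ↔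
      Tendsto (fun n => gromovProduct a (x.1 n) (y.1 n)) atTop atTop :=
  ⟨fun ⟨_, h⟩ => tendsto_gromovProduct_basepoint h a, fun h => ⟨a, h⟩⟩

theorem gromovSCS_isSimpleEnd_iff (a : X) {x : ℕ → X} :
    (gromovSCS X).bounded.IsSimpleEnd x ↔ Tendsto (fun n => dist (x n) a) atTop atTop := by
  constructor
  · intro h
    refine tendsto_atTop.2 fun c => ?_
    have hfin := h (Metric.closedBall a c) Metric.isBounded_closedBall
    rw [← Nat.cofinite_eq_atTop]
    filter_upwards [hfin.compl_mem_cofinite] with n hn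
    simp only [mem_compl_iff, mem_ofPred_eq, Metric.mem_closedBall, not_le] at hn
    exact hn.le
  · intro h A hA
    obtain ⟨r, hr⟩ := Bornology.IsBounded.subset_closedBall hA a
    have := tendsto_atTop.1 h (r + 1)
    rw [← Nat.cofinite_eq_atTop] at this
    refine Set.Finite.subset this fun n hn hn' => ?_
    have := Metric.mem_closedBall.1 (hr hn)
    change r + 1 ≤ dist (x n) a at hn'
    linarith

theorem isCompactification [ProperSpace X] (hgeo : IsGeodesicSpace X) (a : X) :
    IsCompactification (inside : X → GromovCompactification a) :=
  ⟨compactSpace hgeo a, inferInstance, isDenseEmbedding_inside⟩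

theorem slowlyOscillating_of_continuous [ProperSpace X] (hgeo : IsGeodesicSpace X)
    {Z : Type*} [MetricSpace Z] {f : GromovCompactification a → Z} (hf : Continuous f) :
    (gromovSCS X).SlowlyOscillating fun x => f (inside x) := by
  intro x y hxy
  have := compactSpace hgeo a
  rw [gromovSCS_equiv_iff a] at hxy
  refine (tendsto_iff_ultrafilter _ _ _).2 fun l hl => ?_
  -- By compactness the first end converges along the ultrafilter; its limit is a boundary point, to
  -- which the second end then converges too.
  have hx := tendsto_map'_iff.1 (l.map fun n =>
    (inside (x.1 n) : GromovCompactification a)).le_nhds_lim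
  obtain ⟨p, hp⟩ := exists_eq_ideal_of_tendsto hx
    (((gromovSCS_isSimpleEnd_iff a).1 x.2).mono_left hl)
  rw [hp] at hx
  have hy := tendsto_ideal_of_gromovProduct hx (hxy.mono_left hl)
  simpa using ((hf.tendsto _).comp hx).dist ((hf.tendsto _).comp hy)

/-- By density and completeness it suffices that `g` is Cauchy along the trace on `X` of the
neighbourhoods of each boundary point. If it were not, points ever nearer to `p` would form two
equivalent simple ends on which the values of `g` stay `ε` apart. -/
theorem exists_continuous_extension {g : X → Icc (0 : ℝ) 1} (hg : Continuous g)
    (hso : (gromovSCS X).SlowlyOscillating g) (a : X) :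
    ∃ f : GromovCompactification a → Icc (0 : ℝ) 1, Continuous f ∧ ∀ x, f (inside x) = g x := by
  have hd := (isDenseEmbedding_inside (a := a)).isDenseInducing
  obtain ⟨δ, hδ0, hδ⟩ := exists_near_trans a
  refine ⟨hd.extend g, hd.continuous_extend ?_, fun x => hd.extend_eq hg x⟩
  rintro (x | p)
  · refine ⟨g x, ?_⟩
    rw [← hd.nhds_eq_comap]
    exact hg.tendsto x
  · have := hd.comap_nhds_neBot (ideal p)
    refine CompleteSpace.complete (f := map g _)
      (Metric.cauchy_iff.2 ⟨inferInstance, fun ε hε => ?_⟩)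
    by_contra! hcon
    have hxy : ∀ n : ℕ, ∃ x y : X, Near (n : ℝ) (ideal p) (inside x) ∧
        Near (n : ℝ) (ideal p) (inside y) ∧ ε ≤ dist (g x) (g y) := by
      intro n
      obtain ⟨_, ⟨x, hx, rfl⟩, _, ⟨y, hy, rfl⟩, h⟩ := hcon
        (g '' {x | Near (n : ℝ) (ideal p) (inside x)})
        (image_mem_map (preimage_mem_comap
          ((nhds_ideal_hasBasis p).mem_of_mem (i := (n : ℝ)) trivial)))
      exact ⟨x, y, hx, hy, h⟩
    choose x y hx hy hε' using hxy
    have htop := tendsto_natCast_atTop_atTop (R := ℝ)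
    have hxs := (gromovSCS_isSimpleEnd_iff a).2 (tendsto_atTop_mono (fun n => (hx n).le_dist) htop)
    have hys := (gromovSCS_isSimpleEnd_iff a).2 (tendsto_atTop_mono (fun n => (hy n).le_dist) htop)
    have h0 := hso ⟨x, hxs⟩ ⟨y, hys⟩ ((gromovSCS_equiv_iff a).2
      (tendsto_atTop_mono (fun n => near_inside_inside.1 (hδ _ _ _ _ (hx n).symm (hy n)))
        (tendsto_atTop_add_const_right _ (-δ) htop)))
    exact hε.not_ge (ge_of_tendsto' h0 hε')

theorem isHigsonCompactification [ProperSpace X] (hgeo : IsGeodesicSpace X) (a : X) :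
    IsHigsonCompactification (gromovSCS X) (inside : X → GromovCompactification a) where
  toIsCompactification := isCompactification hgeo a
  isCompatible A := ⟨fun h => Bornology.IsBounded.isCompact_closure h,
    fun h => h.isBounded.subset subset_closure⟩
  extends_iff g := by
    constructor
    · rintro ⟨f, hf, hfg⟩
      obtain rfl : (fun x => f (inside x)) = g := funext hfg
      exact ⟨hf.comp isOpenEmbedding_inside.continuous, slowlyOscillating_of_continuous hgeo hf⟩
    · rintro ⟨hg, hso⟩
      exact exists_continuous_extension hg hso a

/-! ### The coarse structure induced by the compactification -/

theorem isBounded_iff_closure_subset [ProperSpace X] (hgeo : IsGeodesicSpace X) {A : Set X} :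
    closure (inside '' A : Set (GromovCompactification a)) ⊆ range inside ↔
      Bornology.IsBounded A := by
  have := compactSpace hgeo a
  constructor
  · intro h
    have hc := (isOpenEmbedding_inside (a := a)).isInducing.isCompact_preimage'
      isClosed_closure.isCompact h
    exact hc.isBounded.subset fun x hx => subset_closure (mem_image_of_mem _ hx)
  · intro h
    have hc := h.isCompact_closure.image (isOpenEmbedding_inside (a := a)).continuous
    exact (closure_minimal (image_mono subset_closure) hc.isClosed).trans (image_subset_range _ _)

theorem closure_range_inter_corona_subset {x y : ℕ → X}
    (h : Tendsto (fun n => gromovProduct a (x n) (y n)) atTop atTop) :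
    closure (range fun n => (inside (x n) : GromovCompactification a)) ∩ corona inside ⊆
      closure (range fun n => (inside (y n) : GromovCompactification a)) ∩ corona inside := by
  rintro ξ ⟨hξ, hξ'⟩
  refine ⟨?_, hξ'⟩
  rw [corona_inside] at hξ'
  obtain ⟨p, rfl⟩ := hξ'
  obtain ⟨δ, hδ0, hδ⟩ := exists_near_trans a
  rw [mem_closure_iff_nhds_basis (nhds_ideal_hasBasis p)] at hξ ⊢
  intro r _
  obtain ⟨N, hN⟩ := eventually_atTop.1 (tendsto_atTop.1 h (r + δ))
  -- Being near `p` at level `M + 1` excludes the finitely many terms before `N`, where the product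
  -- with `y n` is not controlled.
  obtain ⟨M, hM⟩ := ((finite_Iio N).image fun n => dist (x n) a).bddAbove
  obtain ⟨_, ⟨n, rfl⟩, hn⟩ := hξ (max (r + δ) (M + 1)) trivial
  have hn' : N ≤ n := by
    by_contra! hlt
    have h1 : dist (x n) a ≤ M := hM (mem_image_of_mem _ (mem_Iio.2 hlt))
    have h2 := Near.le_dist hn
    have h3 := le_max_right (r + δ) (M + 1)
    linarith
  exact ⟨_, ⟨n, rfl⟩, (hδ _ _ _ _ (Near.mono hn (le_max_left _ _))
    (near_inside_inside.2 (hN n hn'))).mono (by linarith)⟩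

theorem eq_ideal_of_mem_closure_range {y : ℕ → X} {p q : GromovBoundary a}
    (hy : Tendsto (fun n => (inside (y n) : GromovCompactification a)) atTop (𝓝 (ideal q)))
    (hp : ideal p ∈ closure (range fun n => (inside (y n) : GromovCompactification a))) :
    p = q := by
  -- A convergent sequence with its limit is compact, hence closed, and its terms lie in `X`.
  have := closure_minimal (subset_insert _ _) hy.isCompact_insert_range.isClosed hp
  rcases this with h | ⟨n, h⟩ <;> cases h
  rfl

/-- If the products did not diverge, a subsequence would keep them below some `c` while both ends
converge to boundary points. Equality of the traces along that subsequence forces the same limit, so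
the products diverge after all. -/
theorem equiv_of_closure_eq [ProperSpace X] (hgeo : IsGeodesicSpace X) {x y : ℕ → X}
    (hx : Tendsto (fun n => dist (x n) a) atTop atTop)
    (hy : Tendsto (fun n => dist (y n) a) atTop atTop)
    (h : ∀ b : ℕ → ℕ, Tendsto b atTop atTop →
      closure (range fun n => (inside (x (b n)) : GromovCompactification a)) ∩ corona inside =
        closure (range fun n => (inside (y (b n)) : GromovCompactification a)) ∩ corona inside) :
    Tendsto (fun n => gromovProduct a (x n) (y n)) atTop atTop := by
  have := compactSpace hgeo a
  refine tendsto_atTop.2 fun c => ?_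
  by_contra hc
  obtain ⟨b₀, hb₀, hlt⟩ := extraction_of_frequently_atTop (not_eventually.1 hc)
  obtain ⟨ξ, b₁, hb₁, hξ⟩ := CompactSpace.tendsto_subseq
    fun n => (inside (x (b₀ n)) : GromovCompactification a)
  obtain ⟨η, b₂, hb₂, hη⟩ := CompactSpace.tendsto_subseq
    fun n => (inside (y (b₀ (b₁ n))) : GromovCompactification a)
  have hb : Tendsto (fun n => b₀ (b₁ (b₂ n))) atTop atTop :=
    hb₀.tendsto_atTop.comp (hb₁.tendsto_atTop.comp hb₂.tendsto_atTop)
  have hξ' : Tendsto (fun n => (inside (x (b₀ (b₁ (b₂ n)))) : GromovCompactification a)) atTop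
    (𝓝 ξ) := hξ.comp hb₂.tendsto_atTop
  obtain ⟨p, rfl⟩ := exists_eq_ideal_of_tendsto hξ' (hx.comp hb)
  obtain ⟨q, rfl⟩ := exists_eq_ideal_of_tendsto hη (hy.comp hb)
  have hp : ideal p ∈ closure (range fun n => (inside (x (b₀ (b₁ (b₂ n)))) :
      GromovCompactification a)) ∩ corona inside :=
    ⟨mem_closure_of_tendsto hξ' (Eventually.of_forall fun n => mem_range_self n),
      by rw [corona_inside]; exact mem_range_self p⟩
  rw [h _ hb] at hp
  obtain rfl := eq_ideal_of_mem_closure_range hη hp.1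
  obtain ⟨n, hn⟩ := (tendsto_atTop.1 (tendsto_gromovProduct_of_ideal hξ' hη) c).exists
  exact hlt _ hn

end GromovCompactification

/-- The type of simple ends depends on the bounded structure, so the relations are compared on
underlying sequences. -/
theorem SimpleCoarseStructure.ext_of_iff {X : Type*} {S T : SimpleCoarseStructure X}
    (hb : S.bounded = T.bounded)
    (he : ∀ (x y : ℕ → X) (hx : S.bounded.IsSimpleEnd x) (hy : S.bounded.IsSimpleEnd y)
      (hx' : T.bounded.IsSimpleEnd x) (hy' : T.bounded.IsSimpleEnd y),
      S.equiv ⟨x, hx⟩ ⟨y, hy⟩ ↔ T.equiv ⟨x, hx'⟩ ⟨y, hy'⟩) : S = T := by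
  obtain ⟨B, e⟩ := S
  obtain ⟨B', e'⟩ := T
  obtain rfl : B = B' := hb
  congr 1
  ext x y
  exact he x.1 y.1 x.2 y.2 x.2 y.2

theorem BoundedStructure.ext_of_sets {X : Type*} {B C : BoundedStructure X}
    (h : B.sets = C.sets) : B = C := by
  cases B; cases C; congr

theorem extensionSCS_gromovCompactification {X : Type*} [MetricSpace X] [ProperSpace X]
    [IsGromovHyperbolic X] (hgeo : IsGeodesicSpace X) (a : X) :
    extensionSCS (GromovCompactification.inside : X → GromovCompactification a) = gromovSCS X := by
  refine SimpleCoarseStructure.ext_of_iff (BoundedStructure.ext_of_sets ?_) ?_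
  · ext A
    exact GromovCompactification.isBounded_iff_closure_subset hgeo
  · intro x y _ _ hx hy
    refine Iff.trans ?_ (GromovCompactification.gromovSCS_equiv_iff a).symm
    constructor
    · exact GromovCompactification.equiv_of_closure_eq hgeo
        ((GromovCompactification.gromovSCS_isSimpleEnd_iff a).1 hx)
        ((GromovCompactification.gromovSCS_isSimpleEnd_iff a).1 hy)
    · intro h b hb
      refine (GromovCompactification.closure_range_inter_corona_subset (h.comp hb)).antisymm
        (GromovCompactification.closure_range_inter_corona_subset ((h.comp hb).congr fun n => ?_))
      exact gromovProduct_comm _ _ _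

/-! ### Uniqueness of the Higson compactification -/

/-- A dense map into a space extends continuously to a map into a compact Hausdorff space as soon as
all its compositions with continuous functions to `[0, 1]` do. -/
theorem exists_continuous_extension_of_unitInterval {X Y Z : Type*} [TopologicalSpace X]
    [TopologicalSpace Y] [TopologicalSpace Z] [CompactSpace Z] [T2Space Z] {i : X → Y} {e : X → Z}
    (hi : IsDenseInducing i) (he : Continuous e)
    (h : ∀ g : Z → Icc (0 : ℝ) 1, Continuous g →
      ∃ f : Y → Icc (0 : ℝ) 1, Continuous f ∧ ∀ x, f (i x) = g (e x)) :
    ∃ Φ : Y → Z, Continuous Φ ∧ ∀ x, Φ (i x) = e x := by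
  refine ⟨hi.extend e, hi.continuous_extend fun y => ?_, fun x => hi.extend_eq he x⟩
  have := hi.comap_nhds_neBot y
  obtain ⟨c, hc⟩ := exists_clusterPt_of_compactSpace (map e (comap i (𝓝 y)))
  -- In a compact space a filter with a single cluster point converges. A Urysohn function
  -- separating two cluster points would have to take its limit value at both.
  refine ⟨c, le_nhds_of_unique_clusterPt fun c' hc' => ?_⟩
  by_contra hne
  obtain ⟨g, hg0, hg1, hg⟩ := exists_continuous_zero_one_of_isClosed
    (isClosed_singleton (x := c)) (isClosed_singleton (x := c')) (by simpa using Ne.symm hne)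
  obtain ⟨f, hf, hfg⟩ := h (fun z => ⟨g z, hg z⟩) (g.continuous.subtype_mk _)
  have hlim : Tendsto (fun x => g (e x)) (comap i (𝓝 y)) (𝓝 (f y : ℝ)) := by
    have h1 : Tendsto (fun x => (f (i x) : ℝ)) (comap i (𝓝 y)) (𝓝 (f y : ℝ)) :=
      ((continuous_subtype_val.comp hf).tendsto y).comp tendsto_comap
    simpa only [hfg] using h1
  have key : ∀ z, ClusterPt z (map e (comap i (𝓝 y))) → g z = f y := fun z hz =>
    eq_of_nhds_neBot (hz.map g.continuous.continuousAt (tendsto_map'_iff.2 hlim))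
  have e0 := key c hc
  have e1 := key c' hc'
  rw [hg0 rfl] at e0
  rw [hg1 rfl, ← e0] at e1
  simp at e1

/-- Restricting a continuous function on `Z` to `X` gives a continuous slowly oscillating function,
which therefore extends over `Y`. -/
theorem IsHigsonCompactification.exists_map {X Y Z : Type*} [TopologicalSpace X]
    [TopologicalSpace Y] [TopologicalSpace Z] {S : SimpleCoarseStructure X} {i : X → Y} {e : X → Z}
    (hi : IsHigsonCompactification S i) (he : IsHigsonCompactification S e) :
    ∃ Φ : Y → Z, Continuous Φ ∧ ∀ x, Φ (i x) = e x := by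
  have := he.compactSpace
  have := he.t2Space
  refine exists_continuous_extension_of_unitInterval hi.isDenseEmbedding.isDenseInducing
    he.isDenseEmbedding.continuous fun g hg => ?_
  exact (hi.extends_iff _).2 ((he.extends_iff _).1 ⟨g, hg, fun _ => rfl⟩)

/-- The Higson compactification is unique up to a homeomorphism that fixes the space. -/
theorem IsHigsonCompactification.exists_homeomorph {X Y Z : Type*} [TopologicalSpace X]
    [TopologicalSpace Y] [TopologicalSpace Z] {S : SimpleCoarseStructure X} {i : X → Y} {e : X → Z}
    (hi : IsHigsonCompactification S i) (he : IsHigsonCompactification S e) :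
    ∃ Φ : Y ≃ₜ Z, ∀ x, Φ (i x) = e x := by
  have := hi.t2Space
  have := he.t2Space
  obtain ⟨Φ, hΦ, hΦe⟩ := hi.exists_map he
  obtain ⟨Ψ, hΨ, hΨi⟩ := he.exists_map hi
  have h1 : Ψ ∘ Φ = id := hi.isDenseEmbedding.dense.equalizer (hΨ.comp hΦ) continuous_id
    (funext fun x => by simp [hΦe, hΨi])
  have h2 : Φ ∘ Ψ = id := he.isDenseEmbedding.dense.equalizer (hΦ.comp hΨ) continuous_id
    (funext fun x => by simp [hΦe, hΨi])
  exact ⟨⟨⟨Φ, Ψ, congrFun h1, congrFun h2⟩, hΦ, hΨ⟩, hΦe⟩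

theorem Homeomorph.image_corona {X Y Z : Type*} [TopologicalSpace Y] [TopologicalSpace Z]
    {i : X → Y} {e : X → Z} (Φ : Y ≃ₜ Z) (h : ∀ x, Φ (i x) = e x) :
    Φ '' corona i = corona e := by
  rw [corona, corona, image_compl_eq Φ.bijective, ← range_comp]
  congr 2
  exact funext h

theorem theorem5p8 {X : Type*} [MetricSpace X] [ProperSpace X] [IsGromovHyperbolic X]
    (hgeo : IsGeodesicSpace X) (a : X) :
    -- `X ∪ ∂X` is a compactification of `X`, whose corona is the Gromov boundary
    IsCompactification (GromovCompactification.inside : X → GromovCompactification a) ∧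
    IsEmbedding (GromovCompactification.ideal : GromovBoundary a → GromovCompactification a) ∧
    range (GromovCompactification.ideal : GromovBoundary a → GromovCompactification a) =
      corona (GromovCompactification.inside : X → GromovCompactification a) ∧
    -- the two simple coarse structures on `X` coincide
    extensionSCS (GromovCompactification.inside : X → GromovCompactification a) = gromovSCS X ∧
    -- `X ∪ ∂X` is the Higson compactification
    IsHigsonCompactification (gromovSCS X)
      (GromovCompactification.inside : X → GromovCompactification a) ∧
    -- the Higson corona is the Gromov boundary, whichever model `Y` of the Higson
    -- compactification is used
    ∀ {Y : Type*} [TopologicalSpace Y] (e : X → Y), IsHigsonCompactification (gromovSCS X) e →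
      ∃ Φ : GromovCompactification a ≃ₜ Y,
        (∀ x : X, Φ (GromovCompactification.inside x) = e x) ∧
        ∃ φ : GromovBoundary a ≃ₜ corona e,
          ∀ p : GromovBoundary a, (φ p : Y) = Φ (GromovCompactification.ideal p) := by

  have hH := GromovCompactification.isHigsonCompactification hgeo a
  refine ⟨GromovCompactification.isCompactification hgeo a,
    GromovCompactification.isEmbedding_ideal, GromovCompactification.corona_inside.symm,
    extensionSCS_gromovCompactification hgeo a, hH, fun {Y} _ e he => ?_⟩
  obtain ⟨Φ, hΦ⟩ := hH.exists_homeomorph he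
  have hemb := Φ.isEmbedding.comp GromovCompactification.isEmbedding_ideal
  have hrange : range (Φ ∘ GromovCompactification.ideal) = corona e := by
    rw [range_comp, ← GromovCompactification.corona_inside, Φ.image_corona hΦ]
  exact ⟨Φ, hΦ, hemb.toHomeomorph.trans (Homeomorph.setCongr hrange), fun p => rfl⟩
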